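/- For a finite set $A$ let $\Delta(A)$ be the set of probability distributions on $A$, and for a Borel set $\Theta$ in a Euclidean space let $\Delta(\Theta)$ be the set of Borel probability measures on $\Theta$. Let $\mathbb S$ (states) and $\mathbb X$ (actions) be nonempty finite sets, $\Gamma:\mathbb S\to 2^{\mathbb X}$ a constraint correspondence with nonempty values and graph $Gr(\Gamma)=\{(s,x): x\in\Gamma(s)\}$, $q_0\in\Delta(\mathbb S)$ an initial distribution, $Q:Gr(\Gamma)\to\Delta(\mathbb S)$ the true transition probability function, $\pi:Gr(\Gamma)\times\mathbb S\to\mathbb R$ a payoff function and $\delta\in[0,1)$ a discount factor. Let $\{Q_\theta:\theta\in\Theta\}$ be a nonempty family of transition probability functions $Q_\theta:Gr(\Gamma)\to\Delta(\mathbb S)$. These data form a subjective Markov decision process (SMDP). It is *regular* if - $\Theta$ is a compact subset of a Euclidean space; - $\theta\mapsto Q_\theta(s'\mid s,x)$ is continuous on $\Theta$ for all $(s',s,x)\in\mathbb S\times Gr(\Gamma)$; - there is a dense set $\hat\Theta\subseteq\Theta$ such that for all $\theta\in\hat\Theta$, $Q_\theta(s'\mid s,x)>0$ for all $(s',s,x)\in\mathbb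 S\times Gr(\Gamma)$ with $Q(s'\mid s,x)>0$. A *strategy* is a map $\sigma:\mathbb S\to\Delta(\mathbb X)$ with $\sigma(x\mid s)=0$ whenever $x\notin\Gamma(s)$. For a transition probability function $Q'$, let $V_{Q'}:\mathbb S\to\mathbb R$ be the unique solution of the Bellman equation $$V_{Q'}(s)=\max_{x\in\Gamma(s)}\sum_{s'\in\mathbb S}\{\pi(s,x,s')+\delta V_{Q'}(s')\}\,Q'(s'\mid s,x).$$ The strategy $\sigma$ is *optimal* for $Q'$ if for all $s$ and all $x$ with $\sigma(x\mid s)>0$, the action $x$ attains this maximum. A distribution $m\in\Delta(Gr(\Gamma))$ is *stationary* given $(\sigma,Q)$ if $$m(s',x')=\sum_{(s,x)\in Gr(\Gamma)}\sigma(x'\mid s')\,Q(s'\mid s,x)\,m(s,x)\qquad\text{for all }(s',x')\in Gr(\Gamma).$$ The *weighted Kullback–Leibler divergence* of $m\in\Delta(Gr(\Gamma))$ and $\theta\in\Theta$ is $$K_Q(m,\theta)=\sum_{(s,x)\in Gr(\Gamma)}\Big(\sum_{s'\in\mathbb S}Q(s'\mid s,x)\ln\frac{Q(s'\mid s,x)}{Q_\theta(s'\mid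 s,x)}\Big)m(s,x)\in[0,\infty],$$ where terms with $Q(s'\mid s,x)=0$ are $0$, $\ln(q/0)=\infty$ for $q>0$, and $\infty\cdot 0=0$; and $\Theta_Q(m)=\arg\min_{\theta\in\Theta}K_Q(m,\theta)$. A pair $(\sigma,m)$ of a strategy and a distribution $m\in\Delta(Gr(\Gamma))$ is a *Berk–Nash equilibrium* if there is a belief $\mu\in\Delta(\Theta)$ such that (i) $\sigma$ is optimal for the averaged transition probability function $\bar Q_\mu=\int_\Theta Q_\theta\,\mu(d\theta)$; (ii) $\mu$ is concentrated on $\Theta_Q(m)$; and (iii) $m$ is stationary given $(\sigma,Q)$. **Theorem.** Every regular SMDP has a Berk–Nash equilibrium. -/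

import Mathlib

noncomputable section

/-- The graph of a constraint correspondence: the pairs (state, feasible action). -/
def Gr {S X : Type*} (Γ : S → Set X) : Set (S × X) := {p | p.2 ∈ Γ p.1}

instance Gr.fintype {S X : Type*} [Fintype S] [Fintype X] (Γ : S → Set X) :
    Fintype (Gr Γ) := Fintype.ofFinite _

/-- A Markov decision process with finite state space `S` and finite action space `X`.
The set `Δ(A)` of probability distributions on a finite set `A` is `stdSimplex ℝ A`. -/
structure MDP (S X : Type*) [Fintype S] [Fintype X] where
  /-- the constraint correspondence -/
  Γ : S → Set X
  Γ_nonempty : ∀ s, (Γ s).Nonempty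
  /-- the distribution of the initial state -/
  q₀ : stdSimplex ℝ S
  /-- the transition probability function; `Q z s'` is `Q(s' | s, x)` for `z = (s, x)` -/
  Q : Gr Γ → stdSimplex ℝ S
  /-- the per-period payoff -/
  payoff : Gr Γ → S → ℝ
  /-- the discount factor -/
  δ : ℝ
  δ_nonneg : 0 ≤ δ
  δ_lt_one : δ < 1

namespace MDP

variable {S X : Type*} [Fintype S] [Fintype X]

/-- The expected payoff `∫ (π(s, x, s') + δ V(s')) Q(ds' | s, x)` of the feasible pair
`z = (s, x)` when continuation values are given by `V`. -/
def actionValue (M : MDP S X) (V : S → ℝ) (z : Gr M.Γ) : ℝ :=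
  ∑ s', (M.payoff z s' + M.δ * V s') * M.Q z s'

/-- `V` solves the Bellman equation: `V s` is the maximum over `x ∈ Γ s` of the expected
payoff of `x` at `s`. -/
def IsBellmanSolution (M : MDP S X) (V : S → ℝ) : Prop :=
  ∀ s, IsGreatest {v : ℝ | ∃ (x : X) (hx : x ∈ M.Γ s), v = M.actionValue V ⟨(s, x), hx⟩} (V s)

theorem exists_isGreatest (M : MDP S X) (V : S → ℝ) (s : S) :
    ∃ a, IsGreatest {v : ℝ | ∃ (x : X) (hx : x ∈ M.Γ s), v = M.actionValue V ⟨(s, x), hx⟩} a := by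
  obtain ⟨x₀, hx₀⟩ := M.Γ_nonempty s
  have hfin : {v : ℝ | ∃ (x : X) (hx : x ∈ M.Γ s),
      v = M.actionValue V ⟨(s, x), hx⟩}.Finite := by
    refine (Set.finite_range (fun z : Gr M.Γ => M.actionValue V z)).subset ?_
    rintro v ⟨x, hx, rfl⟩
    exact ⟨_, rfl⟩
  exact ⟨_, Set.Nonempty.csSup_mem ⟨_, x₀, hx₀, rfl⟩ hfin,
    fun a ha => le_csSup hfin.bddAbove ha⟩

theorem actionValue_le_add (M : MDP S X) (V W : S → ℝ) (z : Gr M.Γ) :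
    M.actionValue V z ≤ M.actionValue W z + M.δ * dist V W := by
  have hone : ∑ s', M.Q z s' = 1 := (M.Q z).2.2
  have h : M.actionValue W z + M.δ * dist V W
      = ∑ s', (M.payoff z s' + M.δ * (W s' + dist V W)) * M.Q z s' := by
    rw [← mul_one (M.δ * dist V W), ← hone, Finset.mul_sum, actionValue,
      ← Finset.sum_add_distrib]
    exact Finset.sum_congr rfl fun s' _ => by ring
  rw [h]
  refine Finset.sum_le_sum fun s' _ => mul_le_mul_of_nonneg_right ?_ ((M.Q z).2.1 s')
  have h1 : V s' - W s' ≤ dist V W :=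
    (le_abs_self _).trans ((Real.dist_eq (V s') (W s')).symm.le.trans (dist_le_pi_dist V W s'))
  have h2 := mul_le_mul_of_nonneg_left (show V s' ≤ W s' + dist V W by linarith) M.δ_nonneg
  linarith

/-- The Bellman equation has exactly one solution. -/
theorem existsUnique_isBellmanSolution (M : MDP S X) : ∃! V, M.IsBellmanSolution V := by
  choose T hT using M.exists_isGreatest
  have hle : ∀ V W s, T V s ≤ T W s + M.δ * dist V W := by
    intro V W s
    obtain ⟨x, hx, hv⟩ := (hT V s).1
    rw [hv]
    exact (M.actionValue_le_add V W _).trans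
      (add_le_add_left ((hT W s).2 ⟨x, hx, rfl⟩) _)
  have hc : ContractingWith ⟨M.δ, M.δ_nonneg⟩ T := by
    refine ⟨M.δ_lt_one, LipschitzWith.of_dist_le_mul fun V W => ?_⟩
    refine (dist_pi_le_iff (mul_nonneg M.δ_nonneg dist_nonneg)).2 fun s => ?_
    rw [Real.dist_eq, abs_le]
    have h1 := hle V W s
    have h2 := hle W V s
    rw [dist_comm W V] at h2
    constructor
    · change -(M.δ * dist V W) ≤ _
      linarith
    · change _ ≤ M.δ * dist V W
      linarith
  refine ⟨hc.fixedPoint, fun s => ?_, fun V hV => ?_⟩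
  · have h := hT hc.fixedPoint s
    rwa [hc.fixedPoint_isFixedPt] at h
  · exact hc.fixedPoint_unique (funext fun s => (hT V s).unique (hV s))

/-- The value function: the unique solution of the Bellman equation. -/
def value (M : MDP S X) : S → ℝ := M.existsUnique_isBellmanSolution.choose

/-- A strategy assigns to every state a distribution over the actions feasible there. -/
def Strategy (M : MDP S X) : Type _ :=
  {σ : S → stdSimplex ℝ X // ∀ s x, x ∉ M.Γ s → σ s x = 0}

/-- `σ` is optimal: every action played with positive probability at `s` maximizes the
expected payoff, with continuation values `M.value`, over the actions feasible at `s`. -/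
def IsOptimal (M : MDP S X) (σ : M.Strategy) : Prop :=
  ∀ s x, 0 < σ.1 s x → ∃ hx : x ∈ M.Γ s, ∀ (y : X) (hy : y ∈ M.Γ s),
    M.actionValue M.value ⟨(s, y), hy⟩ ≤ M.actionValue M.value ⟨(s, x), hx⟩

/-- The transition kernel `M_{σ,Q}(z' | z) = σ(x' | s') Q(s' | s, x)` on the graph of `Γ`, for
`z = (s, x)` and `z' = (s', x')`. -/
def kernel (M : MDP S X) (σ : M.Strategy) (z z' : Gr M.Γ) : ℝ :=
  σ.1 z'.1.1 z'.1.2 * M.Q z z'.1.1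

/-- `m` is a stationary distribution given `σ` and the transition function of `M`. -/
def IsStationary (M : MDP S X) (σ : M.Strategy) (m : stdSimplex ℝ (Gr M.Γ)) : Prop :=
  ∀ z', m z' = ∑ z, M.kernel σ z z' * m z

/-- The MDP with the same primitives except for the transition function. -/
def withTransition (M : MDP S X) (Q' : Gr M.Γ → stdSimplex ℝ S) : MDP S X :=
  { M with Q := Q' }

end MDP

/-- A subjective Markov decision process: an MDP with a nonempty family of transition
functions `Qsub θ`, indexed by the parameters `θ` in a subset `Θ` of `E`. Measurability in the
parameter makes the averaged transition functions meaningful. -/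
structure SMDP (S X E : Type*) [Fintype S] [Fintype X] [MeasurableSpace E] extends
    MDP S X where
  /-- the set of parameters -/
  Θ : Set E
  Θ_nonempty : Θ.Nonempty
  /-- the subjective transition functions -/
  Qsub : Θ → Gr Γ → stdSimplex ℝ S
  measurable_Qsub : ∀ z s', Measurable fun θ => Qsub θ z s'

namespace SMDP

open MeasureTheory

variable {S X E : Type*} [Fintype S] [Fintype X] [MeasurableSpace E]

/-- Regularity of an SMDP with parameters in a Euclidean space. -/
structure IsRegular {k : ℕ} (P : SMDP S X (EuclideanSpace ℝ (Fin k))) : Prop where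
  isCompact : IsCompact P.Θ
  continuous : ∀ z s', Continuous fun θ => P.Qsub θ z s'
  dense : ∃ D : Set P.Θ, Dense D ∧ ∀ θ ∈ D, ∀ z s', 0 < P.Q z s' → 0 < P.Qsub θ z s'

/-- The weighted Kullback-Leibler divergence
`K(m, θ) = ∑_{(s,x)} E_{Q(· | s,x)} [ln (Q(S' | s,x) / Q_θ(S' | s,x))] m(s,x)`,
with `ln (q / 0) = ∞` for `q > 0` and `0 · ln (0 / q) = 0`, `0 · ∞ = 0`. -/
def wKLD (P : SMDP S X E) (m : stdSimplex ℝ (Gr P.Γ)) (θ : P.Θ) : EReal :=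
  ∑ z, (∑ s', ((P.Q z s' : ℝ) : EReal) *
    ENNReal.log (ENNReal.ofReal (P.Q z s') / ENNReal.ofReal (P.Qsub θ z s'))) * ((m z : ℝ) : EReal)

/-- The closest parameter values given `m`: the minimizers of `K(m, ·)` over `Θ`. -/
def closest (P : SMDP S X E) (m : stdSimplex ℝ (Gr P.Γ)) : Set P.Θ :=
  {θ | ∀ θ', P.wKLD m θ ≤ P.wKLD m θ'}

theorem integrable_Qsub (P : SMDP S X E) (μ : ProbabilityMeasure P.Θ) (z : Gr P.Γ) (s' : S) :
    Integrable (fun θ => P.Qsub θ z s') (μ : Measure P.Θ) := by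
  refine Integrable.of_bound (P.measurable_Qsub z s').aestronglyMeasurable 1
    (Filter.Eventually.of_forall fun θ => ?_)
  have h0 : 0 ≤ P.Qsub θ z s' := (P.Qsub θ z).2.1 s'
  rw [Real.norm_eq_abs, abs_of_nonneg h0]
  exact (mem_Icc_of_mem_stdSimplex (P.Qsub θ z).2 s').2

/-- The averaged transition function `∫ Q_θ μ(dθ)` for the belief `μ`. -/
def meanTransition (P : SMDP S X E) (μ : ProbabilityMeasure P.Θ) (z : Gr P.Γ) :
    stdSimplex ℝ S :=
  ⟨fun s' => ∫ θ, P.Qsub θ z s' ∂(μ : Measure P.Θ),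
    fun s' => integral_nonneg fun θ => (P.Qsub θ z).2.1 s', by
      rw [← integral_finsetSum _ fun s' _ => P.integrable_Qsub μ z s']
      have h : ∀ θ, ∑ s', P.Qsub θ z s' = 1 := fun θ => (P.Qsub θ z).2.2
      simp [h]⟩

/-- `(σ, m)` is a Berk-Nash equilibrium: for some belief `μ` on `Θ`, the strategy `σ` is optimal
for the MDP with the averaged transition function, `μ` is concentrated on the closest parameter
values given `m`, and `m` is stationary given `σ` and the true transition function. -/
def IsBerkNash (P : SMDP S X E) (σ : P.toMDP.Strategy) (m : stdSimplex ℝ (Gr P.Γ)) : Prop :=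
  ∃ μ : ProbabilityMeasure P.Θ,
    (P.toMDP.withTransition (P.meanTransition μ)).IsOptimal σ ∧
    (∀ᵐ θ ∂(μ : Measure P.Θ), θ ∈ P.closest m) ∧
    P.toMDP.IsStationary σ m

end SMDP

end

/-!
Consider the correspondence that sends a triple `(σ, m, q)`, with `q` the transition probability
function believed to be true, to all triples formed by a strategy optimal for `q`, the
distribution `push σ m` of next period's state and action, and some `Q_θ` with `θ` closest given
`m`. A triple lying in the convex hull of its own image is a Berk–Nash equilibrium: optimality for
`q` is a convex condition on strategies, and a mixture of the `Q_θ` over closest parameters is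
`Q̄_μ` for a finitely supported belief `μ`. Such triples exist by Kakutani's theorem once the
correspondence has a closed graph.

The delicate point is closedness of `m ↦ Θ_Q(m)`, since `K_Q` may be infinite. It is continuous in
`θ` and jointly lower semicontinuous, and it is continuous in `m` at the parameters `θ ∈ Θ̂`, where
it is finite; by continuity in `θ` it suffices to compare with these when testing minimality.

Kakutani's theorem is reduced to `C¹` maps with bounded range by smooth partitions of unity. For
these it is Brouwer's theorem, a consequence of the absence of a `C¹` retraction `r` of a ball
onto its boundary: the integral of `det (1 + t • (r' - 1))` over the ball is a polynomial in `t`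
which for small `t` is the volume of the ball, because `id + t • (r - id)` is then a bijection of
the ball, whereas at `t = 1` it vanishes.
-/

section Brouwer

open Metric MeasureTheory Filter Topology
open scoped NNReal

theorem exists_det_one_add_eq_sum {K V : Type*} [Field K] [AddCommGroup V] [Module K V]
    [FiniteDimensional K V] {T : Finset K} (hT : Module.finrank K V < T.card) :
    ∃ c : K → K, ∑ t ∈ T, c t = 1 ∧
      ∀ A : V →ₗ[K] V, LinearMap.det (1 + A) = ∑ t ∈ T, c t * LinearMap.det (1 + t • A) := by
  classical
  have key (A : V →ₗ[K] V) : LinearMap.det (1 + A)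
      = ∑ t ∈ T, (Lagrange.basis T id t).eval 1 * LinearMap.det (1 + t • A) := by
    let b := Module.finBasis K V
    let M := LinearMap.toMatrix b b A
    let p : Polynomial K := ((Polynomial.X : Polynomial K) • M.map Polynomial.C
      + (1 : Matrix _ _ K).map Polynomial.C).det
    have hp (t : K) : p.eval t = LinearMap.det (1 + t • A) := by
      rw [← LinearMap.det_toMatrix b, ← Polynomial.coe_evalRingHom, RingHom.map_det]
      congr 1
      ext i j
      simp only [M, RingHom.mapMatrix_apply, Matrix.map_apply, Matrix.add_apply, Matrix.smul_apply,
        Polynomial.coe_evalRingHom, smul_eq_mul, Polynomial.eval_mul,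
        Polynomial.eval_X, Polynomial.eval_C, map_add, map_smul, LinearMap.toMatrix_one]
      exact add_comm _ _
    have hdeg : p.degree < T.card := by
      refine Polynomial.degree_le_natDegree.trans_lt (WithBot.coe_lt_coe.2 ?_)
      exact (Polynomial.natDegree_det_X_add_C_le M 1).trans_lt (by simpa using hT)
    have h := congrArg (Polynomial.eval 1)
      (Lagrange.eq_interpolate (v := id) Function.injective_id.injOn hdeg)
    rw [hp, one_smul, Lagrange.interpolate_apply, Polynomial.eval_finsetSum] at h
    simpa only [Polynomial.eval_mul, Polynomial.eval_C, id, hp, mul_comm] using h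
  exact ⟨_, by simpa using (key 0).symm, key⟩

theorem inter_frontier_nonempty_of_isPreconnected {X : Type*} [TopologicalSpace X] {s t : Set X}
    (ht : IsPreconnected t) {x y : X} (hx : x ∈ t) (hxs : x ∈ s) (hy : y ∈ t) (hys : y ∉ s) :
    (t ∩ frontier s).Nonempty := by
  by_contra! h
  have hfr : ∀ z ∈ t, z ∈ closure s → z ∈ interior s := fun z hz hzs => by
    by_contra hzi
    exact h.le ⟨hz, hzs, hzi⟩
  refine hys (interior_subset (ht.subset_of_closure_inter_subset isOpen_interior
    ⟨x, hx, hfr x hx (subset_closure hxs)⟩ (fun z hz => ?_) hy))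
  exact hfr z hz.2 (closure_mono interior_subset hz.1)

section NormedSpace

variable {V : Type*} [NormedAddCommGroup V] [NormedSpace ℝ V] {K : ℝ≥0} {g : V → V}

theorem lipschitzWith_indicator {F : Type*} [SeminormedAddCommGroup F] {g : V → F} {s : Set V}
    (hs : IsClosed s) (hg : LipschitzOnWith K g s) (h0 : ∀ x ∈ frontier s, g x = 0) :
    LipschitzWith K (s.indicator g) := by
  have mixed : ∀ x ∈ s, ∀ y ∉ s, dist (g x) 0 ≤ K * dist x y := fun x hx y hy => by
    obtain ⟨z, hz, hzs⟩ := inter_frontier_nonempty_of_isPreconnected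
      (convex_segment x y).isPreconnected (left_mem_segment ℝ x y) hx (right_mem_segment ℝ x y) hy
    have hxz : dist x z ≤ dist x y :=
      (le_add_of_nonneg_right dist_nonneg).trans_eq (dist_add_dist_of_mem_segment hz)
    rw [← h0 z hzs]
    exact (hg.dist_le_mul x hx z (hs.frontier_subset hzs)).trans (by gcongr)
  refine LipschitzWith.of_dist_le_mul fun x y => ?_
  by_cases hx : x ∈ s <;> by_cases hy : y ∈ s
  · simpa [hx, hy] using hg.dist_le_mul x hx y hy
  · simpa only [hx, hy, Set.indicator_of_mem, not_false_eq_true, Set.indicator_of_notMem]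
      using mixed x hx y hy
  · simpa only [hx, hy, Set.indicator_of_mem, not_false_eq_true, Set.indicator_of_notMem,
      dist_comm] using mixed y hy x hx
  · simpa [hx, hy] using mul_nonneg K.2 dist_nonneg

theorem bijective_id_add_of_lipschitzWith [CompleteSpace V] (hK : K < 1)
    (hg : LipschitzWith K g) : Function.Bijective (id + g) := by
  have h : ApproximatesLinearOn (id + g) (ContinuousLinearEquiv.refl ℝ V : V →L[ℝ] V)
      Set.univ K := by
    rw [ApproximatesLinearOn.approximatesLinearOn_iff_lipschitzOnWith]
    convert hg.lipschitzOnWith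
    exact add_sub_cancel_left id g
  refine (h.toHomeomorph _ ?_).bijective
  rcases subsingleton_or_nontrivial V with hV | hV
  · exact .inl hV
  · exact .inr (by simpa using hK)

theorem image_eq_of_bijective_of_eqOn_compl {α : Type*} {f : α → α} {s : Set α}
    (hf : Function.Bijective f) (hs : Set.EqOn f id sᶜ) : f '' s = s := by
  rw [← compl_inj_iff, ← Set.image_compl_eq hf, hs.image_eq, Set.image_id]

theorem image_id_add_eq_of_lipschitzWith [CompleteSpace V] {s : Set V} (hK : K < 1)
    (hg : LipschitzWith K g) (h0 : ∀ x ∉ s, g x = 0) : (id + g) '' s = s :=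
  image_eq_of_bijective_of_eqOn_compl (bijective_id_add_of_lipschitzWith hK hg)
    fun x hx => by simp [h0 x hx]

theorem eventually_det_one_add_pos : ∀ᶠ B : V →L[ℝ] V in 𝓝 0, 0 < (1 + B).det := by
  have hc : Continuous fun B : V →L[ℝ] V => (1 + B).det :=
    ContinuousLinearMap.continuous_det.comp (continuous_const_add 1)
  exact hc.continuousAt.eventually (lt_mem_nhds (by simp [ContinuousLinearMap.det]))

variable [FiniteDimensional ℝ V]

section Measure

variable [MeasurableSpace V] [BorelSpace V] (μ : Measure V)
  [μ.IsAddHaarMeasure] {s : Set V} {g' : V → V →L[ℝ] V}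

theorem integrableOn_abs_det_one_add (hs : MeasurableSet s) (hμs : μ s ≠ ⊤) (hK : K < 1)
    (hg : LipschitzWith K g) (hg' : ∀ x ∈ s, HasFDerivWithinAt g (g' x) s x)
    (h0 : ∀ x ∉ s, g x = 0) :
    IntegrableOn (fun x => |(1 + g' x).det|) s μ := by
  have h := integrableOn_image_iff_integrableOn_abs_det_fderiv_smul μ hs
    (fun x hx => (hasFDerivWithinAt_id x s).add (hg' x hx))
    (bijective_id_add_of_lipschitzWith hK hg).injective.injOn fun _ => (1 : ℝ)
  rw [image_id_add_eq_of_lipschitzWith hK hg h0] at h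
  simpa using! h.1 (integrableOn_const hμs)

theorem setIntegral_abs_det_one_add (hs : MeasurableSet s) (hK : K < 1)
    (hg : LipschitzWith K g) (hg' : ∀ x ∈ s, HasFDerivWithinAt g (g' x) s x)
    (h0 : ∀ x ∉ s, g x = 0) : ∫ x in s, |(1 + g' x).det| ∂μ = μ.real s := by
  have h := integral_image_eq_integral_abs_det_fderiv_smul μ hs
    (fun x hx => (hasFDerivWithinAt_id x s).add (hg' x hx))
    (bijective_id_add_of_lipschitzWith hK hg).injective.injOn fun _ => (1 : ℝ)
  rw [image_id_add_eq_of_lipschitzWith hK hg h0] at h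
  simpa using! h.symm

theorem eventually_setIntegral_det_one_add_smul (hs : MeasurableSet s) (hμs : μ s ≠ ⊤)
    (hg : LipschitzWith K g) (hg' : ∀ x ∈ s, HasFDerivAt g (g' x) x) (h0 : ∀ x ∉ s, g x = 0) :
    ∀ᶠ t : ℝ in 𝓝 0, IntegrableOn (fun x => (1 + t • g' x).det) s μ ∧
      ∫ x in s, (1 + t • g' x).det ∂μ = μ.real s := by
  have hK : ∀ᶠ t : ℝ in 𝓝 0, ‖t‖₊ * K < 1 :=
    (by fun_prop : Continuous fun t : ℝ => ‖t‖₊ * K).continuousAt.eventually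
      (gt_mem_nhds (by simp))
  have hdet : ∀ᶠ t : ℝ in 𝓝 0, ∀ x ∈ s, 0 < (1 + t • g' x).det := by
    obtain ⟨ε, hε, hball⟩ := Metric.eventually_nhds_iff.1 (eventually_det_one_add_pos (V := V))
    have ht : ∀ᶠ t : ℝ in 𝓝 0, ‖t‖ * K < ε :=
      (by fun_prop : Continuous fun t : ℝ => ‖t‖ * K).continuousAt.eventually
        (gt_mem_nhds (by simpa))
    filter_upwards [ht] with t ht x hx
    refine hball ?_
    rw [dist_zero_right, norm_smul]
    exact (mul_le_mul_of_nonneg_left ((hg' x hx).le_of_lipschitz hg) (norm_nonneg t)).trans_lt ht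
  filter_upwards [hK, hdet] with t htK hdet
  have hgt : LipschitzWith (‖t‖₊ * K) (t • g) := (lipschitzWith_smul t).comp hg
  have hgt' : ∀ x ∈ s, HasFDerivWithinAt (t • g) (t • g' x) s x := fun x hx =>
    ((hg' x hx).const_smul t).hasFDerivWithinAt
  have h0t : ∀ x ∉ s, (t • g) x = 0 := fun x hx => by simp [h0 x hx]
  have habs : Set.EqOn (fun x => |(1 + t • g' x).det|) (fun x => (1 + t • g' x).det) s :=
    fun x hx => abs_of_pos (hdet x hx)
  exact ⟨(integrableOn_abs_det_one_add μ hs hμs htK hgt hgt' h0t).congr_fun habs hs,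
    (setIntegral_congr_fun hs habs).symm.trans
      (setIntegral_abs_det_one_add μ hs htK hgt hgt' h0t)⟩

-- The integral is a polynomial in the scaling of `g`, and it is constant near `0`.
theorem setIntegral_det_one_add (hs : MeasurableSet s) (hμs : μ s ≠ ⊤)
    (hg : LipschitzWith K g) (hg' : ∀ x ∈ s, HasFDerivAt g (g' x) x)
    (h0 : ∀ x ∉ s, g x = 0) : ∫ x in s, (1 + g' x).det ∂μ = μ.real s := by
  have hsmall := eventually_setIntegral_det_one_add_smul μ hs hμs hg hg' h0
  obtain ⟨T, hT, hcard⟩ :=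
    (infinite_of_mem_nhds (0 : ℝ) hsmall).exists_subset_card_eq (Module.finrank ℝ V + 1)
  obtain ⟨c, hc1, hc⟩ :=
    exists_det_one_add_eq_sum (V := V) ((Nat.lt_succ_self _).trans_eq hcard.symm)
  calc ∫ x in s, (1 + g' x).det ∂μ = ∫ x in s, ∑ t ∈ T, c t * (1 + t • g' x).det ∂μ :=
        setIntegral_congr_fun hs fun x _ => hc (g' x)
    _ = ∑ t ∈ T, c t * ∫ x in s, (1 + t • g' x).det ∂μ := by
        rw [integral_finsetSum T fun t ht => (hT ht).1.const_mul (c t)]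
        simp only [integral_const_mul]
    _ = ∑ t ∈ T, c t * μ.real s :=
        Finset.sum_congr rfl fun t ht => by rw [(hT ht).2]
    _ = μ.real s := by rw [← Finset.sum_mul, hc1, one_mul]

end Measure

theorem det_eq_zero_of_mapsTo_of_interior_eq_empty {s t : Set V} {r : V → V} {r' : V →L[ℝ] V}
    {x : V} (hr : HasStrictFDerivAt r r' x) (hs : s ∈ 𝓝 x) (hmap : Set.MapsTo r s t)
    (ht : interior t = ∅) : r'.det = 0 := by
  by_contra hdet
  have hopen := hr.map_nhds_eq_of_surj
    (LinearMap.range_eq_top.2 (LinearMap.equivOfDetNeZero _ hdet).surjective)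
  have hmem : t ∈ 𝓝 (r x) := hopen ▸ mem_map.2 (mem_of_superset hs hmap)
  exact ht.le (mem_interior_iff_mem_nhds.2 hmem)

theorem not_mapsTo_frontier_of_eqOn_id {s : Set V} (hs : IsCompact s) (hconv : Convex ℝ s)
    (hne : (interior s).Nonempty) {r : V → V} (hr : ∀ x ∈ s, ContDiffAt ℝ 1 r x)
    (hfix : Set.EqOn r id (frontier s)) : ¬ Set.MapsTo r s (frontier s) := by
  intro hmap
  borelize V
  let μ : Measure V := Measure.addHaar
  have hd : ∀ x ∈ s, HasFDerivAt (r - id) (fderiv ℝ r x - 1) x := fun x hx =>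
    ((hr x hx).differentiableAt one_ne_zero).hasFDerivAt.sub (hasFDerivAt_id x)
  obtain ⟨K, hK⟩ : ∃ K, LipschitzOnWith K (r - id) s := by
    have hc : ContinuousOn (fun x => ‖fderiv ℝ r x - 1‖₊) s := fun x hx =>
      (((hr x hx).fderiv_right (m := 0) (by simp)).continuousAt.sub
        continuousAt_const).nnnorm.continuousWithinAt
    obtain ⟨K, hK⟩ := (hs.image_of_continuousOn hc).bddAbove
    exact ⟨K, hconv.lipschitzOnWith_of_nnnorm_hasFDerivWithin_le
      (fun x hx => (hd x hx).hasFDerivWithinAt) fun x hx => hK (Set.mem_image_of_mem _ hx)⟩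
  have hsing : ∀ x ∈ interior s, (fderiv ℝ r x).det = 0 := fun x hx =>
    det_eq_zero_of_mapsTo_of_interior_eq_empty
      ((hr x (interior_subset hx)).hasStrictFDerivAt one_ne_zero)
      (mem_interior_iff_mem_nhds.1 hx) hmap (interior_frontier hs.isClosed)
  have hvol : ∫ x in interior s, (1 + (fderiv ℝ r x - 1)).det ∂μ = μ.real (interior s) := by
    refine setIntegral_det_one_add μ isOpen_interior.measurableSet
      (measure_ne_top_of_subset interior_subset hs.measure_lt_top.ne)
      (lipschitzWith_indicator hs.isClosed hK fun x hx => sub_eq_zero.2 (hfix hx))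
      (fun x hx => (hd x (interior_subset hx)).congr_of_eventuallyEq ?_) fun x hx => ?_
    · filter_upwards [mem_interior_iff_mem_nhds.1 hx] with y hy using Set.indicator_of_mem hy _
    · exact Set.indicator_apply_eq_zero.2 fun hxs => sub_eq_zero.2 (hfix ⟨subset_closure hxs, hx⟩)
  have hpos : 0 < μ.real (interior s) :=
    ENNReal.toReal_pos (isOpen_interior.measure_pos μ hne).ne'
      (measure_ne_top_of_subset interior_subset hs.measure_lt_top.ne)
  refine hpos.ne ?_
  rw [← hvol, setIntegral_congr_fun isOpen_interior.measurableSet fun x hx =>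
    by simpa using hsing x hx, integral_zero]

end NormedSpace

section InnerProductSpace

open scoped RealInnerProductSpace

variable {F : Type*} [NormedAddCommGroup F] [InnerProductSpace ℝ F] {R : ℝ} {x u : F}

/-- The time at which the ray `t ↦ x + t • u` leaves the ball of radius `R` around the origin: the
larger root of the quadratic equation `‖x + t • u‖ ^ 2 = R ^ 2`. -/
noncomputable def exitTime (R : ℝ) (x u : F) : ℝ :=
  (-⟪x, u⟫ + √(⟪x, u⟫ ^ 2 + ⟪u, u⟫ * (R ^ 2 - ⟪x, x⟫))) / ⟪u, u⟫

theorem norm_add_exitTime_smul (hu : u ≠ 0) (hx : ‖x‖ ≤ R) : ‖x + exitTime R x u • u‖ = R := by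
  have hR : 0 ≤ R := (norm_nonneg x).trans hx
  have hdisc : 0 ≤ ⟪x, u⟫ ^ 2 + ⟪u, u⟫ * (R ^ 2 - ⟪x, x⟫) := by
    rw [real_inner_self_eq_norm_sq x]
    exact add_nonneg (sq_nonneg _) (mul_nonneg real_inner_self_nonneg
      (sub_nonneg.2 (pow_le_pow_left₀ (norm_nonneg x) hx 2)))
  have hu' : ⟪u, u⟫ ≠ 0 := inner_self_ne_zero.2 hu
  refine (pow_left_inj₀ (norm_nonneg _) hR two_ne_zero).1 ?_
  have hexp (t : ℝ) : ‖x + t • u‖ ^ 2 = ⟪u, u⟫ * (t * t) + 2 * ⟪x, u⟫ * t + ⟪x, x⟫ := by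
    rw [← real_inner_self_eq_norm_sq, inner_add_add_self]
    simp only [real_inner_smul_left, real_inner_smul_right, real_inner_comm x u]
    ring
  rw [hexp, exitTime]
  field_simp
  linear_combination Real.sq_sqrt hdisc

theorem exitTime_eq_zero (hx : ‖x‖ = R) (hxu : 0 ≤ ⟪x, u⟫) : exitTime R x u = 0 := by
  simp [exitTime, hx, Real.sqrt_sq hxu]

theorem contDiffAt_exitTime {E : Type*} [NormedAddCommGroup E] [NormedSpace ℝ E] {a : E}
    {f h : E → F} {n : WithTop ℕ∞} (hf : ContDiffAt ℝ n f a) (hh : ContDiffAt ℝ n h a)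
    (hu : h a ≠ 0) (hx : ‖f a‖ ≤ R) (hin : ‖f a‖ = R → 0 < ⟪f a, h a⟫) :
    ContDiffAt ℝ n (fun y => exitTime R (f y) (h y)) a := by
  have hdisc : 0 < ⟪f a, h a⟫ ^ 2 + ⟪h a, h a⟫ * (R ^ 2 - ⟪f a, f a⟫) := by
    have hu' : 0 < ⟪h a, h a⟫ := real_inner_self_pos.2 hu
    rcases hx.lt_or_eq with hlt | heq
    · have : 0 < R ^ 2 - ⟪f a, f a⟫ := by
        rw [real_inner_self_eq_norm_sq]
        exact sub_pos.2 (pow_lt_pow_left₀ hlt (norm_nonneg _) two_ne_zero)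
      positivity
    · have := hin heq
      rw [real_inner_self_eq_norm_sq (f a), heq, sub_self, mul_zero, add_zero]
      positivity
  have hfh := hf.inner ℝ hh
  have hhh := hh.inner ℝ hh
  exact (hfh.neg.add (((hfh.pow 2).add
    (hhh.mul (contDiffAt_const.sub (hf.inner ℝ hf)))).sqrt hdisc.ne')).div hhh
      (inner_self_ne_zero.2 hu)

theorem inner_sub_pos_of_norm_le {y : F} (hyx : ‖y‖ ≤ ‖x‖) (hne : y ≠ x) : 0 < ⟪x, x - y⟫ := by
  have h : 0 < ‖x - y‖ ^ 2 := by
    have := norm_pos_iff.2 (sub_ne_zero.2 hne.symm)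
    positivity
  have := pow_le_pow_left₀ (norm_nonneg y) hyx 2
  rw [norm_sub_sq_real] at h
  rw [inner_sub_right, real_inner_self_eq_norm_sq]
  linarith

theorem exists_fixedPoint_of_mapsTo_closedBall [FiniteDimensional ℝ F] (hR : 0 < R) {f : F → F}
    (hf : ∀ x ∈ closedBall 0 R, ContDiffAt ℝ 1 f x)
    (hmap : Set.MapsTo f (closedBall 0 R) (closedBall 0 R)) : ∃ x, f x = x := by
  by_contra! hne
  have hnorm : ∀ x, x ∈ closedBall (0 : F) R ↔ ‖x‖ ≤ R := fun x => mem_closedBall_zero_iff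
  have hfr : frontier (closedBall (0 : F) R) = sphere 0 R := frontier_closedBall 0 hR.ne'
  have hin : ∀ x, ‖x‖ = R → 0 < ⟪x, x - f x⟫ := fun x hx =>
    inner_sub_pos_of_norm_le (((hnorm _).1 (hmap ((hnorm x).2 hx.le))).trans_eq hx.symm) (hne x)
  have hu : ∀ x, x - f x ≠ 0 := fun x => sub_ne_zero.2 (hne x).symm
  refine not_mapsTo_frontier_of_eqOn_id (r := fun x => x + exitTime R x (x - f x) • (x - f x))
    (isCompact_closedBall 0 R) (convex_closedBall 0 R) ?_ (fun x hx => ?_) ?_ fun x hx => ?_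
  · exact ⟨0, ball_subset_interior_closedBall (mem_ball_self hR)⟩
  · have hsub := contDiffAt_id.sub (hf x hx)
    exact contDiffAt_id.add ((contDiffAt_exitTime contDiffAt_id hsub (hu x) ((hnorm x).1 hx)
      (hin x)).smul hsub)
  · rw [hfr]
    intro x hx
    have hx' := mem_sphere_zero_iff_norm.1 hx
    simp [exitTime_eq_zero hx' (hin x hx').le]
  · rw [hfr, mem_sphere_zero_iff_norm]
    exact norm_add_exitTime_smul (hu x) ((hnorm x).1 hx)

end InnerProductSpace

theorem exists_fixedPoint_of_isBounded_range {V : Type*} [NormedAddCommGroup V] [NormedSpace ℝ V]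
    [FiniteDimensional ℝ V] {f : V → V} (hf : ContDiff ℝ 1 f)
    (hb : Bornology.IsBounded (Set.range f)) : ∃ x, f x = x := by
  let e : V ≃L[ℝ] EuclideanSpace ℝ (Fin (Module.finrank ℝ V)) := toEuclidean
  obtain ⟨R, hR, hsub⟩ := (e.lipschitz.isBounded_image hb).subset_closedBall_lt 0 0
  obtain ⟨x, hx⟩ := exists_fixedPoint_of_mapsTo_closedBall (f := e ∘ f ∘ e.symm) hR
    (fun x _ => (e.contDiff.comp (hf.comp e.symm.contDiff)).contDiffAt)
    fun x _ => hsub ⟨_, ⟨e.symm x, rfl⟩, rfl⟩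
  exact ⟨e.symm x, (e.symm_apply_eq.2 hx.symm).symm⟩

end Brouwer

theorem convexHull_eq_iUnion_image_stdSimplex_prod_pi {𝕜 V : Type*} [Field 𝕜] [LinearOrder 𝕜]
    [IsStrictOrderedRing 𝕜] [AddCommGroup V] [Module 𝕜 V] [FiniteDimensional 𝕜 V] (C : Set V) :
    convexHull 𝕜 C = ⋃ n ∈ Set.Iic (Module.finrank 𝕜 V + 1),
      (fun p : (Fin n → 𝕜) × (Fin n → V) => ∑ i, p.1 i • p.2 i) ''
        (stdSimplex 𝕜 (Fin n) ×ˢ Set.univ.pi fun _ => C) := by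
  refine Set.Subset.antisymm (fun x hx => ?_) (Set.iUnion₂_subset fun n _ => ?_)
  · obtain ⟨ι, _, z, w, hz, hind, hw, hw1, rfl⟩ := eq_pos_convex_span_of_mem_convexHull hx
    let e := Fintype.equivFin ι
    have hcard : Fintype.card ι ≤ Module.finrank 𝕜 V + 1 :=
      hind.card_le_finrank_succ.trans (Nat.succ_le_succ (Submodule.finrank_le _))
    refine Set.mem_biUnion (Set.mem_Iic.2 hcard) ⟨(w ∘ e.symm, z ∘ e.symm), ⟨⟨fun i => (hw _).le,
      ?_⟩, fun i _ => hz ⟨_, rfl⟩⟩, e.symm.sum_comp fun i => w i • z i⟩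
    rw [← hw1]
    exact e.symm.sum_comp w
  · rintro _ ⟨⟨w, z⟩, ⟨hw, hz⟩, rfl⟩
    exact (convex_convexHull 𝕜 C).sum_mem (fun i _ => hw.1 i) hw.2
      fun i _ => subset_convexHull 𝕜 C (hz i (Set.mem_univ i))

theorem isCompact_convexHull {V : Type*} [AddCommGroup V] [Module ℝ V] [TopologicalSpace V]
    [ContinuousAdd V] [ContinuousSMul ℝ V] [FiniteDimensional ℝ V] {C : Set V}
    (hC : IsCompact C) : IsCompact (convexHull ℝ C) := by
  rw [convexHull_eq_iUnion_image_stdSimplex_prod_pi]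
  exact (Set.finite_Iic _).isCompact_biUnion fun n _ =>
    ((isCompact_stdSimplex ℝ (Fin n)).prod (isCompact_univ_pi fun _ => hC)).image (by fun_prop)

section Kakutani

open Metric Filter Topology
open scoped Manifold

variable {V : Type*} [NormedAddCommGroup V] [NormedSpace ℝ V] [FiniteDimensional ℝ V] {K : Set V}

theorem exists_mem_convexHull_image_inter_ball (hK : IsCompact K) (hconv : Convex ℝ K)
    (hne : K.Nonempty) {y : V → V} (hy : Set.MapsTo y K K) {ε : ℝ} (hε : 0 < ε) :
    ∃ x ∈ K, x ∈ convexHull ℝ (y '' (K ∩ ball x ε)) := by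
  let c : V → Set V := fun x => convexHull ℝ (y '' (K ∩ ball x (infDist x K + ε)))
  have hloc : ∀ x, ∃ v, ∀ᶠ x' in 𝓝 x, v ∈ c x' := fun x => by
    obtain ⟨k, hk, hxk⟩ := (infDist_lt_iff hne).1 (lt_add_of_pos_right (infDist x K) hε)
    have hopen : ∀ᶠ x' in 𝓝 x, dist x' k < infDist x' K + ε :=
      (isOpen_lt (by fun_prop) ((continuous_infDist_pt K).add_const ε)).mem_nhds hxk
    refine ⟨y k, hopen.mono fun x' hx' => subset_convexHull ℝ _ ⟨k, ⟨hk, ?_⟩, rfl⟩⟩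
    rwa [mem_ball']
  obtain ⟨f, hf⟩ := exists_contMDiffMap_forall_mem_convex_of_local_const (n := 1) 𝓘(ℝ, V)
    (fun x => convex_convexHull ℝ _) hloc
  have hfK : ∀ x, f x ∈ K := fun x =>
    convexHull_min ((Set.image_mono Set.inter_subset_left).trans hy.image_subset) hconv (hf x)
  obtain ⟨x, hx⟩ := exists_fixedPoint_of_isBounded_range f.contMDiff.contDiff
    (hK.isBounded.subset (Set.range_subset_iff.2 hfK))
  have hxK : x ∈ K := hx ▸ hfK x
  have hxc : x ∈ c x := by simpa only [hx] using hf x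
  simp only [c, infDist_zero_of_mem hxK, zero_add] at hxc
  exact ⟨x, hxK, hxc⟩

theorem eventually_forall_mem_of_isClosed {X Y : Type*} [TopologicalSpace X] [TopologicalSpace Y]
    {K U : Set Y} {G : Set (X × Y)} (hK : IsCompact K) (hG : IsClosed G) (hU : IsOpen U) {a : X}
    (ha : ∀ y ∈ K, (a, y) ∈ G → y ∈ U) : ∀ᶠ x in 𝓝 a, ∀ y ∈ K, (x, y) ∈ G → y ∈ U := by
  refine hK.eventually_forall_of_forall_eventually fun y hy => ?_
  by_cases h : (a, y) ∈ G
  · filter_upwards [(hU.preimage continuous_snd).mem_nhds (ha y hy h)] with p hp _ using hp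
  · filter_upwards [hG.isOpen_compl.mem_nhds h] with p hp hpG using absurd hpG hp

theorem exists_mem_convexHull_of_isClosed (hK : IsCompact K) (hconv : Convex ℝ K)
    (hne : K.Nonempty) {G : Set (V × V)} (hG : IsClosed G)
    (hGne : ∀ x ∈ K, ∃ y ∈ K, (x, y) ∈ G) :
    ∃ x ∈ K, x ∈ convexHull ℝ {y | y ∈ K ∧ (x, y) ∈ G} := by
  choose! y hyK hyG using hGne
  choose x hxK hx using fun n : ℕ =>
    exists_mem_convexHull_image_inter_ball hK hconv hne hyK
      (Nat.one_div_pos_of_nat (n := n) (α := ℝ))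
  obtain ⟨a, haK, φ, hφ, ha⟩ := hK.tendsto_subseq hxK
  let C : Set V := {z | z ∈ K ∧ (a, z) ∈ G}
  have hC : IsCompact C := hK.inter_right (hG.preimage (Continuous.prodMk_right a))
  have hthick : ∀ η > 0, ∀ᶠ n in atTop, x (φ n) ∈ thickening η (convexHull ℝ C) := fun η hη => by
    have hnear : ∀ᶠ z in 𝓝 a, ∀ v ∈ K, (z, v) ∈ G → v ∈ thickening η (convexHull ℝ C) :=
      eventually_forall_mem_of_isClosed hK hG isOpen_thickening fun v hv hav =>
        self_subset_thickening hη _ (subset_convexHull ℝ C ⟨hv, hav⟩)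
    obtain ⟨r, hr, hball⟩ := Metric.eventually_nhds_iff_ball.1 hnear
    have hsmall : ∀ᶠ n in atTop, 1 / ((φ n : ℝ) + 1) < r / 2 :=
      hφ.tendsto_atTop.eventually
        (tendsto_one_div_add_atTop_nhds_zero_nat.eventually_lt_const (half_pos hr))
    filter_upwards [hsmall, ha (ball_mem_nhds a (half_pos hr))] with n hn hxn
    refine convexHull_min ?_ ((convex_convexHull ℝ C).thickening η) (hx (φ n))
    rintro _ ⟨z, ⟨hzK, hz⟩, rfl⟩
    have hza : dist z a < r / 2 + r / 2 :=
      (dist_triangle z (x (φ n)) a).trans_lt (add_lt_add ((mem_ball.1 hz).trans hn) hxn)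
    exact hball z (by rwa [add_halves] at hza) _ (hyK z hzK) (hyG z hzK)
  refine ⟨a, haK, ?_⟩
  rw [← (isCompact_convexHull hC).isClosed.closure_eq, closure_eq_iInter_cthickening]
  exact Set.mem_iInter₂.2 fun η hη => isClosed_cthickening.mem_of_tendsto ha
    ((hthick η hη).mono fun n hn => thickening_subset_cthickening η _ hn)

theorem exists_mem_convexHull_image_of_isClosed {T : Type*} [TopologicalSpace T] [CompactSpace T]
    [Nonempty T] {φ : T → V} (hφ : Continuous φ) (hinj : Function.Injective φ)
    (hconv : Convex ℝ (Set.range φ)) {F : T → Set T} (hF : IsClosed {p : T × T | p.2 ∈ F p.1})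
    (hne : ∀ t, (F t).Nonempty) : ∃ t, φ t ∈ convexHull ℝ (φ '' F t) := by
  have hG : IsClosed (Prod.map φ φ '' {p : T × T | p.2 ∈ F p.1}) :=
    (hF.isCompact.image (hφ.prodMap hφ)).isClosed
  obtain ⟨_, ⟨t, rfl⟩, ht⟩ := exists_mem_convexHull_of_isClosed (isCompact_range hφ) hconv
    (Set.range_nonempty φ) hG fun _ ⟨t, ht⟩ =>
      let ⟨u, hu⟩ := hne t
      ⟨φ u, ⟨u, rfl⟩, (t, u), hu, Prod.ext ht rfl⟩
  refine ⟨t, convexHull_mono ?_ ht⟩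
  rintro _ ⟨-, ⟨t', u⟩, hu, h⟩
  obtain ⟨ht, rfl⟩ := Prod.mk.inj h
  exact ⟨u, hinj ht ▸ hu, rfl⟩

end Kakutani

section RelativeEntropy

open Filter

section EReal

variable {ι T : Type*} [TopologicalSpace T]

theorem sum_coe_ereal (s : Finset ι) (f : ι → ℝ) :
    ∑ i ∈ s, (f i : EReal) = ((∑ i ∈ s, f i : ℝ) : EReal) := by
  classical
  induction s using Finset.induction_on with
  | empty => simp
  | insert i s hi ih => rw [Finset.sum_insert hi, Finset.sum_insert hi, ih, EReal.coe_add]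

theorem sum_ereal_ne_bot {s : Finset ι} {f : ι → EReal} (hf : ∀ i ∈ s, f i ≠ ⊥) :
    ∑ i ∈ s, f i ≠ ⊥ :=
  Finset.sum_induction f (· ≠ ⊥) (fun _ _ ha hb => EReal.add_ne_bot_iff.2 ⟨ha, hb⟩)
    EReal.zero_ne_bot hf

theorem sum_ereal_ne_top {s : Finset ι} {f : ι → EReal} (hf : ∀ i ∈ s, f i ≠ ⊤) :
    ∑ i ∈ s, f i ≠ ⊤ :=
  Finset.sum_induction f (· ≠ ⊤) (fun _ _ ha hb => EReal.add_ne_top ha hb) EReal.zero_ne_top hf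

theorem continuous_sum_ereal (s : Finset ι) {f : ι → T → EReal} (hf : ∀ i, Continuous (f i))
    (hbot : ∀ i t, f i t ≠ ⊥) : Continuous fun t => ∑ i ∈ s, f i t := by
  classical
  induction s using Finset.induction_on with
  | empty => simpa only [Finset.sum_empty] using continuous_const
  | insert i s hi ih =>
    simp only [Finset.sum_insert hi]
    refine continuous_iff_continuousAt.2 fun t => ?_
    exact (EReal.continuousAt_add (p := (f i t, ∑ j ∈ s, f j t))
      (.inr (sum_ereal_ne_bot fun j _ => hbot j t)) (.inl (hbot i t))).comp
      (f := fun t => (f i t, ∑ j ∈ s, f j t)) ((hf i).continuousAt.prodMk ih.continuousAt)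

theorem lowerSemicontinuous_sum_ereal (s : Finset ι) {f : ι → T → EReal}
    (hf : ∀ i, LowerSemicontinuous (f i)) (hbot : ∀ i t, f i t ≠ ⊥) :
    LowerSemicontinuous fun t => ∑ i ∈ s, f i t := by
  classical
  induction s using Finset.induction_on with
  | empty => simpa only [Finset.sum_empty] using lowerSemicontinuous_const
  | insert i s hi ih =>
    simp only [Finset.sum_insert hi]
    exact (hf i).add' ih fun t => EReal.continuousAt_add
      (.inr (sum_ereal_ne_bot fun j _ => hbot j t)) (.inl (hbot i t))

theorem lowerSemicontinuous_mul_coe_ereal {f : T → EReal} {g : T → ℝ} (hf : Continuous f)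
    (hf0 : ∀ t, 0 ≤ f t) (hg : Continuous g) (hg0 : ∀ t, 0 ≤ g t) :
    LowerSemicontinuous fun t => f t * (g t : EReal) := by
  intro t
  by_cases h : g t = 0
  · intro y hy
    simp only [h, EReal.coe_zero, mul_zero, gt_iff_lt] at hy
    exact Eventually.of_forall fun t' =>
      hy.trans_le (mul_nonneg (hf0 t') (EReal.coe_nonneg.2 (hg0 t')))
  · have hgt : (g t : EReal) ≠ 0 := EReal.coe_ne_zero.2 h
    exact ((EReal.continuousAt_mul (p := (f t, (g t : EReal))) (.inr (EReal.coe_ne_bot _))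
      (.inr (EReal.coe_ne_top _)) (.inr hgt) (.inr hgt)).comp
      (f := fun t => (f t, (g t : EReal)))
      (hf.prodMk (continuous_coe_real_ereal.comp hg)).continuousAt).lowerSemicontinuousAt

theorem continuous_mul_coe_ereal {f : T → EReal} (hf : Continuous f) (c : ℝ) :
    Continuous fun t => f t * (c : EReal) := by
  by_cases h : c = 0
  · simpa only [h, EReal.coe_zero, mul_zero] using continuous_const
  · exact continuous_iff_continuousAt.2 fun t => EReal.Tendsto.mul_const hf.continuousAt
      (.inr (EReal.coe_ne_bot c)) (.inr (EReal.coe_ne_top c))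

end EReal

theorem coe_sub_le_mul_log {a b : ℝ} (ha : 0 ≤ a) (hb : 0 ≤ b) :
    ((a - b : ℝ) : EReal) ≤ a * ENNReal.log (ENNReal.ofReal a / ENNReal.ofReal b) := by
  rcases ha.eq_or_lt with rfl | ha
  · simpa using hb
  rcases hb.eq_or_lt with rfl | hb
  · rw [ENNReal.ofReal_zero, ENNReal.div_zero (ENNReal.ofReal_pos.2 ha).ne', ENNReal.log_top,
      EReal.mul_top_of_pos (EReal.coe_pos.2 ha)]
    exact le_top
  rw [← ENNReal.ofReal_div_of_pos hb, ENNReal.log_ofReal_of_pos (div_pos ha hb),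
    ← EReal.coe_mul, EReal.coe_le_coe_iff]
  calc a - b = a * (1 - (a / b)⁻¹) := by field_simp
    _ ≤ a * Real.log (a / b) :=
      mul_le_mul_of_nonneg_left (Real.one_sub_inv_le_log_of_pos (div_pos ha hb)) ha.le

theorem mul_log_ne_top {a b : ℝ} (ha : 0 ≤ a) (h : 0 < a → 0 < b) :
    (a : EReal) * ENNReal.log (ENNReal.ofReal a / ENNReal.ofReal b) ≠ ⊤ := by
  rcases ha.eq_or_lt with rfl | ha
  · simp
  · rw [← ENNReal.ofReal_div_of_pos (h ha), ENNReal.log_ofReal_of_pos (div_pos ha (h ha)),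
      ← EReal.coe_mul]
    exact EReal.coe_ne_top _

theorem continuous_mul_log (a : ℝ) : Continuous fun b : ℝ =>
    (a : EReal) * ENNReal.log (ENNReal.ofReal a / ENNReal.ofReal b) := by
  simp only [mul_comm (a : EReal)]
  exact continuous_mul_coe_ereal (ENNReal.continuous_log.comp <| continuous_iff_continuousAt.2
    fun b => ENNReal.Tendsto.const_div ENNReal.continuous_ofReal.continuousAt
      (.inr ENNReal.ofReal_ne_top)) a

variable {ι : Type*} [Fintype ι]

/-- The relative entropy (Kullback–Leibler divergence) of distributions on a finite set, in the
form in which it occurs in the weighted divergence `SMDP.wKLD`. -/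
noncomputable def relEntropy (p q : stdSimplex ℝ ι) : EReal :=
  ∑ i, ((p i : ℝ) : EReal) * ENNReal.log (ENNReal.ofReal (p i) / ENNReal.ofReal (q i))

theorem continuous_stdSimplex_apply (i : ι) : Continuous fun p : stdSimplex ℝ ι => p i :=
  (continuous_apply i).comp continuous_subtype_val

theorem relEntropy_nonneg (p q : stdSimplex ℝ ι) : 0 ≤ relEntropy p q :=
  calc (0 : EReal) = ∑ i, ((p i - q i : ℝ) : EReal) := by
        rw [sum_coe_ereal, Finset.sum_sub_distrib, stdSimplex.sum_eq_one, stdSimplex.sum_eq_one,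
          sub_self, EReal.coe_zero]
    _ ≤ relEntropy p q := Finset.sum_le_sum fun i _ =>
        coe_sub_le_mul_log (stdSimplex.zero_le p i) (stdSimplex.zero_le q i)

theorem relEntropy_ne_top {p q : stdSimplex ℝ ι} (h : ∀ i, 0 < p i → 0 < q i) :
    relEntropy p q ≠ ⊤ :=
  sum_ereal_ne_top fun i _ => mul_log_ne_top (stdSimplex.zero_le p i) (h i)

theorem continuous_relEntropy (p : stdSimplex ℝ ι) : Continuous (relEntropy p) :=
  continuous_sum_ereal _ (fun i => (continuous_mul_log (p i)).comp (continuous_stdSimplex_apply i))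
    fun i q => ((EReal.bot_lt_coe _).trans_le
      (coe_sub_le_mul_log (stdSimplex.zero_le p i) (stdSimplex.zero_le q i))).ne'

end RelativeEntropy

section Argmin

variable {A B R : Type*} [TopologicalSpace A] [TopologicalSpace B] [TopologicalSpace R]
  [LinearOrder R] [ClosedIciTopology R] {K : A → B → R}

theorem isClosed_setOf_forall_le {D : Set B} (hD : Dense D)
    (hK : LowerSemicontinuous (Function.uncurry K)) (hB : ∀ a, Continuous (K a))
    (hA : ∀ b ∈ D, Continuous fun a => K a b) :
    IsClosed {p : A × B | ∀ b, K p.1 p.2 ≤ K p.1 b} := by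
  have heq : {p : A × B | ∀ b, K p.1 p.2 ≤ K p.1 b}
      = ⋂ b ∈ D, (fun p : A × B => (p, K p.1 b)) ⁻¹' {x | Function.uncurry K x.1 ≤ x.2} := by
    ext p
    simp only [Set.mem_iInter]
    refine ⟨fun h b _ => h b, fun h b => ?_⟩
    have hcl : IsClosed {b | K p.1 p.2 ≤ K p.1 b} := isClosed_Ici.preimage (hB p.1)
    exact hcl.closure_subset_iff.2 h (hD b)
  rw [heq]
  exact isClosed_biInter fun b hb => hK.isClosed_epigraph.preimage
    (continuous_id.prodMk ((hA b hb).comp continuous_fst))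

end Argmin

section ClosestParameters

variable {S X E : Type*} [Fintype S] [Fintype X] [MeasurableSpace E] {P : SMDP S X E}

namespace SMDP

theorem relEntropy_mul_ne_bot (m : stdSimplex ℝ (Gr P.Γ)) (θ : P.Θ) (z : Gr P.Γ) :
    relEntropy (P.Q z) (P.Qsub θ z) * ((m z : ℝ) : EReal) ≠ ⊥ :=
  (EReal.bot_lt_zero.trans_le (mul_nonneg (relEntropy_nonneg _ _)
    (EReal.coe_nonneg.2 (stdSimplex.zero_le m z)))).ne'

theorem continuous_wKLD_left {θ : P.Θ} (hpos : ∀ z s', 0 < P.Q z s' → 0 < P.Qsub θ z s') :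
    Continuous fun m => P.wKLD m θ := by
  refine continuous_sum_ereal _ (fun z => ?_) fun z m => relEntropy_mul_ne_bot m θ z
  change Continuous fun m : stdSimplex ℝ (Gr P.Γ) =>
    relEntropy (P.Q z) (P.Qsub θ z) * ((m z : ℝ) : EReal)
  lift relEntropy (P.Q z) (P.Qsub θ z) to ℝ using
    ⟨relEntropy_ne_top (hpos z), (EReal.bot_lt_zero.trans_le (relEntropy_nonneg _ _)).ne'⟩ with r
  simp only [← EReal.coe_mul]
  exact continuous_coe_real_ereal.comp (continuous_const.mul (continuous_stdSimplex_apply z))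

variable [TopologicalSpace E]

theorem continuous_Qsub (hcont : ∀ z s', Continuous fun θ => P.Qsub θ z s') :
    Continuous P.Qsub :=
  continuous_pi fun z => continuous_induced_rng.2 (continuous_pi fun s' => hcont z s')

theorem continuous_relEntropy_Qsub (hcont : Continuous P.Qsub) (z : Gr P.Γ) :
    Continuous fun θ => relEntropy (P.Q z) (P.Qsub θ z) :=
  (continuous_relEntropy _).comp ((continuous_apply z).comp hcont)

theorem continuous_wKLD (hcont : Continuous P.Qsub) (m : stdSimplex ℝ (Gr P.Γ)) :
    Continuous (P.wKLD m) :=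
  continuous_sum_ereal _
    (fun z => continuous_mul_coe_ereal (continuous_relEntropy_Qsub hcont z) (m z))
    fun z θ => relEntropy_mul_ne_bot m θ z

theorem lowerSemicontinuous_uncurry_wKLD (hcont : Continuous P.Qsub) :
    LowerSemicontinuous (Function.uncurry P.wKLD) :=
  lowerSemicontinuous_sum_ereal _
    (fun z => lowerSemicontinuous_mul_coe_ereal
      ((continuous_relEntropy_Qsub hcont z).comp continuous_snd)
      (fun _ => relEntropy_nonneg _ _)
      ((continuous_stdSimplex_apply z).comp continuous_fst) fun p => stdSimplex.zero_le p.1 z)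
    fun z p => relEntropy_mul_ne_bot p.1 p.2 z

theorem isClosed_setOf_mem_closest (hcont : Continuous P.Qsub) {D : Set P.Θ} (hD : Dense D)
    (hpos : ∀ θ ∈ D, ∀ z s', 0 < P.Q z s' → 0 < P.Qsub θ z s') :
    IsClosed {p : stdSimplex ℝ (Gr P.Γ) × P.Θ | p.2 ∈ P.closest p.1} :=
  isClosed_setOf_forall_le hD (lowerSemicontinuous_uncurry_wKLD hcont) (continuous_wKLD hcont)
    fun θ hθ => continuous_wKLD_left (hpos θ hθ)

theorem closest_nonempty (hΘ : IsCompact P.Θ) (hcont : Continuous P.Qsub)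
    (m : stdSimplex ℝ (Gr P.Γ)) : (P.closest m).Nonempty := by
  have : CompactSpace P.Θ := isCompact_iff_compactSpace.1 hΘ
  have : Nonempty P.Θ := P.Θ_nonempty.to_subtype
  obtain ⟨θ, -, hθ⟩ := isCompact_univ.exists_isMinOn Set.univ_nonempty
    (continuous_wKLD hcont m).continuousOn
  exact ⟨θ, fun θ' => hθ (Set.mem_univ θ')⟩

end SMDP

end ClosestParameters

section DecisionProcess

variable {S X : Type*} [Fintype S] [Fintype X]

namespace MDP

theorem nonempty_gr (M : MDP S X) : Nonempty (Gr M.Γ) := by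
  rcases isEmpty_or_nonempty S with hS | ⟨⟨s⟩⟩
  · exact absurd (stdSimplex.sum_eq_one M.q₀) (by simp)
  · obtain ⟨x, hx⟩ := M.Γ_nonempty s
    exact ⟨⟨(s, x), hx⟩⟩

theorem value_isBellmanSolution (M : MDP S X) : M.IsBellmanSolution M.value :=
  M.existsUnique_isBellmanSolution.choose_spec.1

theorem actionValue_value_le (M : MDP S X) (z : Gr M.Γ) :
    M.actionValue M.value z ≤ M.value z.1.1 :=
  (M.value_isBellmanSolution z.1.1).2 ⟨z.1.2, z.2, rfl⟩

theorem exists_value_eq_actionValue (M : MDP S X) (s : S) :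
    ∃ (x : X) (hx : x ∈ M.Γ s), M.value s = M.actionValue M.value ⟨(s, x), hx⟩ :=
  (M.value_isBellmanSolution s).1

theorem dist_value_withTransition_le (M : MDP S X) (q q' : Gr M.Γ → stdSimplex ℝ S) :
    dist (M.withTransition q').value (M.withTransition q).value ≤
      (1 - M.δ)⁻¹ * dist
        ((M.withTransition q').actionValue (M.withTransition q).value : Gr M.Γ → ℝ)
        ((M.withTransition q).actionValue (M.withTransition q).value) := by
  set N := M.withTransition q
  set N' := M.withTransition q'
  set e := dist (N'.actionValue N.value : Gr M.Γ → ℝ) (N.actionValue N.value)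
  have he : ∀ z : Gr M.Γ, |N'.actionValue N.value z - N.actionValue N.value z| ≤ e :=
    dist_le_pi_dist (N'.actionValue N.value : Gr M.Γ → ℝ) (N.actionValue N.value)
  have hcontr : dist N'.value N.value ≤ e + M.δ * dist N'.value N.value := by
    refine (dist_pi_le_iff (add_nonneg dist_nonneg
      (mul_nonneg M.δ_nonneg dist_nonneg))).2 fun s => abs_sub_le_iff.2 ⟨?_, ?_⟩
    · obtain ⟨x, hx, hv⟩ := N'.exists_value_eq_actionValue s
      let z : Gr M.Γ := ⟨(s, x), hx⟩
      calc N'.value s - N.value s ≤ N'.actionValue N'.value z - N.actionValue N.value z :=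
            sub_le_sub hv.le (N.actionValue_value_le z)
        _ ≤ (N'.actionValue N.value z + M.δ * dist N'.value N.value)
            - N.actionValue N.value z := sub_le_sub_right (N'.actionValue_le_add _ _ z) _
        _ ≤ e + M.δ * dist N'.value N.value := by linarith [(abs_le.1 (he z)).2]
    · obtain ⟨x, hx, hv⟩ := N.exists_value_eq_actionValue s
      let z : Gr M.Γ := ⟨(s, x), hx⟩
      have hlip : N'.actionValue N.value z
          ≤ N'.actionValue N'.value z + M.δ * dist N'.value N.value :=
        dist_comm N.value N'.value ▸ N'.actionValue_le_add _ _ z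
      calc N.value s - N'.value s ≤ N.actionValue N.value z - N'.actionValue N'.value z :=
            sub_le_sub hv.le (N'.actionValue_value_le z)
        _ ≤ e + M.δ * dist N'.value N.value := by linarith [(abs_le.1 (he z)).1]
  rw [inv_mul_eq_div, le_div_iff₀ (sub_pos.2 M.δ_lt_one)]
  linarith

theorem continuous_actionValue_withTransition (M : MDP S X) :
    Continuous fun (p : (S → ℝ) × (Gr M.Γ → stdSimplex ℝ S)) (z : Gr M.Γ) =>
      (M.withTransition p.2).actionValue p.1 z :=
  continuous_pi fun z => continuous_finsetSum _ fun s' _ =>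
    (continuous_const.add (continuous_const.mul ((continuous_apply s').comp continuous_fst))).mul
      ((continuous_stdSimplex_apply s').comp ((continuous_apply z).comp continuous_snd))

theorem continuous_value_withTransition (M : MDP S X) :
    Continuous fun q : Gr M.Γ → stdSimplex ℝ S => (M.withTransition q).value := by
  refine continuous_iff_continuousAt.2 fun q => tendsto_iff_dist_tendsto_zero.2 ?_
  refine squeeze_zero (fun _ => dist_nonneg) (fun q' => M.dist_value_withTransition_le q q') ?_
  have hlim := tendsto_iff_dist_tendsto_zero.1 ((M.continuous_actionValue_withTransition.comp
    (Continuous.prodMk_right (M.withTransition q).value)).tendsto q)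
  exact mul_zero (1 - M.δ)⁻¹ ▸ hlim.const_mul _

/-- The loss of value from the feasible pair `z` relative to an optimal action. -/
noncomputable def slack (M : MDP S X) (z : Gr M.Γ) : ℝ :=
  M.value z.1.1 - M.actionValue M.value z

theorem continuous_slack_withTransition (M : MDP S X) (z : Gr M.Γ) :
    Continuous fun q : Gr M.Γ → stdSimplex ℝ S => (M.withTransition q).slack z :=
  ((continuous_apply z.1.1).comp M.continuous_value_withTransition).sub
    ((continuous_apply z).comp (M.continuous_actionValue_withTransition.comp
      (M.continuous_value_withTransition.prodMk continuous_id)))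

theorem isOptimal_iff_forall_mul_slack_eq_zero {M : MDP S X} {σ : M.Strategy} :
    M.IsOptimal σ ↔ ∀ z : Gr M.Γ, σ.1 z.1.1 z.1.2 * M.slack z = 0 := by
  constructor
  · rintro hσ ⟨⟨s, x⟩, hx⟩
    rcases (stdSimplex.zero_le (σ.1 s) x).eq_or_lt with h0 | hpos
    · exact mul_eq_zero_of_left h0.symm _
    · obtain ⟨_, hmax⟩ := hσ s x hpos
      obtain ⟨y, hy, hv⟩ := M.exists_value_eq_actionValue s
      exact mul_eq_zero_of_right _ (sub_eq_zero.2
        ((hv.le.trans (hmax y hy)).antisymm (M.actionValue_value_le ⟨(s, x), hx⟩)))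
  · intro h s x hpos
    have hx : x ∈ M.Γ s := of_not_not fun hx => hpos.ne' (σ.2 s x hx)
    have hslack : M.slack ⟨(s, x), hx⟩ = 0 :=
      (mul_eq_zero.1 (h ⟨(s, x), hx⟩)).resolve_left hpos.ne'
    exact ⟨hx, fun y hy => (M.actionValue_value_le ⟨(s, y), hy⟩).trans (sub_eq_zero.1 hslack).le⟩

theorem exists_isOptimal (M : MDP S X) : ∃ σ : M.Strategy, M.IsOptimal σ := by
  classical
  choose x hx hv using M.exists_value_eq_actionValue
  refine ⟨⟨fun s => ⟨Pi.single (x s) 1, single_mem_stdSimplex ℝ _⟩, fun s y hy =>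
    Pi.single_eq_of_ne (fun h : y = x s => hy (h ▸ hx s)) _⟩,
    isOptimal_iff_forall_mul_slack_eq_zero.2 ?_⟩
  rintro ⟨⟨s, y⟩, hy⟩
  obtain rfl | hne := eq_or_ne y (x s)
  · exact mul_eq_zero_of_right _ (sub_eq_zero.2 (hv s))
  · exact mul_eq_zero_of_left (Pi.single_eq_of_ne hne _) _

theorem sum_strategy_mul {M : MDP S X} (σ : M.Strategy) (w : S → ℝ) :
    ∑ z : Gr M.Γ, σ.1 z.1.1 z.1.2 * w z.1.1 = ∑ s, w s := by
  classical
  have hsupp : ∀ p : S × X, p ∉ Gr M.Γ → σ.1 p.1 p.2 * w p.1 = 0 := fun p hp =>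
    mul_eq_zero_of_left (σ.2 p.1 p.2 hp) _
  calc ∑ z : Gr M.Γ, σ.1 z.1.1 z.1.2 * w z.1.1
      = ∑ p : S × X, σ.1 p.1 p.2 * w p.1 :=
        Fintype.sum_of_injective Subtype.val Subtype.val_injective _ _
          (fun p hp => hsupp p fun hΓ => hp ⟨⟨p, hΓ⟩, rfl⟩) fun _ => rfl
    _ = ∑ s, (∑ x, σ.1 s x) * w s := by
        simp only [Fintype.sum_prod_type, Finset.sum_mul]
    _ = ∑ s, w s := by simp only [stdSimplex.sum_eq_one, one_mul]

/-- The distribution of next period's state and action, when the current one is `m` and actions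
are chosen by `σ`; stationary distributions are the fixed points of `M.push σ`. -/
noncomputable def push (M : MDP S X) (σ : M.Strategy) (m : stdSimplex ℝ (Gr M.Γ)) :
    stdSimplex ℝ (Gr M.Γ) :=
  ⟨fun z' => ∑ z, M.kernel σ z z' * m z,
    fun z' => Finset.sum_nonneg fun z _ => mul_nonneg
      (mul_nonneg (stdSimplex.zero_le _ _) (stdSimplex.zero_le _ _)) (stdSimplex.zero_le _ _), by
      simp only [kernel, mul_assoc, ← Finset.mul_sum]
      rw [sum_strategy_mul σ fun s => ∑ z, M.Q z s * m z, Finset.sum_comm]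
      simp only [← Finset.sum_mul, stdSimplex.sum_eq_one, one_mul]⟩

theorem isStationary_of_eq_push {M : MDP S X} {σ : M.Strategy} {m : stdSimplex ℝ (Gr M.Γ)}
    (h : m = M.push σ m) : M.IsStationary σ m :=
  fun z' => congrArg (· z') h

namespace Strategy

variable {M : MDP S X}

instance : TopologicalSpace M.Strategy :=
  inferInstanceAs (TopologicalSpace {σ : S → stdSimplex ℝ X // ∀ s x, x ∉ M.Γ s → σ s x = 0})

instance : Nonempty M.Strategy := ⟨M.exists_isOptimal.choose⟩

theorem continuous_apply (s : S) (x : X) : Continuous fun σ : M.Strategy => σ.1 s x :=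
  (continuous_stdSimplex_apply x).comp ((_root_.continuous_apply s).comp continuous_subtype_val)

instance : CompactSpace M.Strategy := by
  have hclosed : IsClosed {σ : S → stdSimplex ℝ X | ∀ s x, x ∉ M.Γ s → σ s x = 0} := by
    simp only [Set.ofPred_forall]
    exact isClosed_iInter fun s => isClosed_iInter fun x => isClosed_iInter fun _ => isClosed_eq
      ((continuous_stdSimplex_apply x).comp (_root_.continuous_apply s)) continuous_const
  exact isCompact_iff_compactSpace.1 hclosed.isCompact

/-- The choice probabilities of a strategy, as a point of the vector space in which mixtures of
strategies are formed. -/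
def prob (σ : M.Strategy) : S → X → ℝ := fun s x => σ.1 s x

theorem continuous_prob : Continuous (prob : M.Strategy → S → X → ℝ) :=
  continuous_pi fun s => continuous_pi fun x => continuous_apply s x

theorem prob_injective : Function.Injective (prob : M.Strategy → S → X → ℝ) := fun _ _ h =>
  Subtype.ext (funext fun s => stdSimplex.ext (congrFun h s))

theorem range_prob : Set.range (prob : M.Strategy → S → X → ℝ)
    = Set.univ.pi fun s => stdSimplex ℝ X ∩ {f | ∀ x ∉ M.Γ s, f x = 0} := by
  ext f
  refine ⟨?_, fun hf => ⟨⟨fun s => ⟨f s, (hf s trivial).1⟩, fun s => (hf s trivial).2⟩, rfl⟩⟩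
  rintro ⟨σ, rfl⟩ s -
  exact ⟨(σ.1 s).2, σ.2 s⟩

theorem convex_range_prob : Convex ℝ (Set.range (prob : M.Strategy → S → X → ℝ)) := by
  rw [range_prob]
  refine convex_pi fun s _ => (convex_stdSimplex ℝ X).inter fun f hf g hg a b _ _ _ x hx => ?_
  simp only [Pi.add_apply, Pi.smul_apply, hf x hx, hg x hx, smul_zero, add_zero]

end Strategy

theorem isOptimal_of_prob_mem_convexHull {M : MDP S X} {σ : M.Strategy}
    (hσ : σ.prob ∈ convexHull ℝ (Strategy.prob '' {σ' : M.Strategy | M.IsOptimal σ'})) :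
    M.IsOptimal σ := by
  let C : Set (S → X → ℝ) := {f | ∀ z : Gr M.Γ, f z.1.1 z.1.2 * M.slack z = 0}
  have hC : Convex ℝ C := fun f hf g hg a b _ _ _ z => by
    simp only [Pi.add_apply, Pi.smul_apply, smul_eq_mul, add_mul, mul_assoc, hf z, hg z, mul_zero,
      add_zero]
  have hsub : Strategy.prob '' {σ' : M.Strategy | M.IsOptimal σ'} ⊆ C := by
    rintro _ ⟨σ', hσ', rfl⟩
    exact isOptimal_iff_forall_mul_slack_eq_zero.1 hσ'
  exact isOptimal_iff_forall_mul_slack_eq_zero.2 (convexHull_min hsub hC hσ)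

theorem isClosed_setOf_isOptimal_withTransition (M : MDP S X) :
    IsClosed {p : M.Strategy × (Gr M.Γ → stdSimplex ℝ S) |
      (M.withTransition p.2).IsOptimal p.1} := by
  have heq : {p : M.Strategy × (Gr M.Γ → stdSimplex ℝ S) | (M.withTransition p.2).IsOptimal p.1}
      = ⋂ z : Gr M.Γ, {p : M.Strategy × (Gr M.Γ → stdSimplex ℝ S) |
          p.1.1 z.1.1 z.1.2 * (M.withTransition p.2).slack z = 0} := by
    ext p
    rw [Set.mem_iInter]
    exact isOptimal_iff_forall_mul_slack_eq_zero (M := M.withTransition p.2)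
  rw [heq]
  exact isClosed_iInter fun z : Gr M.Γ => isClosed_eq
    (((Strategy.continuous_apply z.1.1 z.1.2).comp continuous_fst).mul
      ((M.continuous_slack_withTransition z).comp continuous_snd)) continuous_const

theorem continuous_push (M : MDP S X) :
    Continuous fun p : M.Strategy × stdSimplex ℝ (Gr M.Γ) => M.push p.1 p.2 :=
  continuous_induced_rng.2 <| continuous_pi fun z' => continuous_finsetSum _ fun z _ =>
    (((Strategy.continuous_apply z'.1.1 z'.1.2).comp continuous_fst).mul continuous_const).mul
      ((continuous_stdSimplex_apply z).comp continuous_snd)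

end MDP

end DecisionProcess

section Barycenter

open MeasureTheory

theorem exists_probabilityMeasure_integral_eq_of_mem_convexHull {Ω V : Type*} [MeasurableSpace Ω]
    [MeasurableSingletonClass Ω] [NormedAddCommGroup V] [NormedSpace ℝ V] [CompleteSpace V]
    {f : Ω → V} {C : Set Ω} {v : V} (hv : v ∈ convexHull ℝ (f '' C)) :
    ∃ μ : ProbabilityMeasure Ω, (∀ᵐ ω ∂(μ : Measure Ω), ω ∈ C) ∧
      Integrable f (μ : Measure Ω) ∧ ∫ ω, f ω ∂(μ : Measure Ω) = v := by
  refine convexHull_min (t := {v | ∃ μ : ProbabilityMeasure Ω, (∀ᵐ ω ∂(μ : Measure Ω), ω ∈ C) ∧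
    Integrable f (μ : Measure Ω) ∧ ∫ ω, f ω ∂(μ : Measure Ω) = v}) ?_ ?_ hv
  · rintro _ ⟨ω, hω, rfl⟩
    refine ⟨⟨Measure.dirac ω, inferInstance⟩, ?_, integrable_dirac enorm_lt_top,
      integral_dirac f ω⟩
    rwa [ProbabilityMeasure.coe_mk, ae_dirac_eq]
  · rintro _ ⟨μ, hμC, hμ, rfl⟩ _ ⟨ν, hνC, hν, rfl⟩ a b ha hb hab
    let ρ : Measure Ω := ENNReal.ofReal a • (μ : Measure Ω) + ENNReal.ofReal b • (ν : Measure Ω)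
    have hρ : IsProbabilityMeasure ρ := ⟨by simp [ρ, ← ENNReal.ofReal_add ha hb, hab]⟩
    have hμ' : Integrable f (ENNReal.ofReal a • (μ : Measure Ω)) :=
      hμ.smul_measure ENNReal.ofReal_ne_top
    have hν' : Integrable f (ENNReal.ofReal b • (ν : Measure Ω)) :=
      hν.smul_measure ENNReal.ofReal_ne_top
    refine ⟨⟨ρ, hρ⟩, ae_add_measure_iff.2
      ⟨Measure.ae_smul_measure hμC _, Measure.ae_smul_measure hνC _⟩, hμ'.add_measure hν', ?_⟩
    rw [ProbabilityMeasure.coe_mk, integral_add_measure hμ' hν', integral_smul_measure,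
      integral_smul_measure, ENNReal.toReal_ofReal ha, ENNReal.toReal_ofReal hb]

end Barycenter

section Equilibrium

open MeasureTheory

/-- The real-valued function underlying a transition probability function, as a point of the
vector space in which mixtures are formed. -/
def transitionProb {S Z : Type*} [Fintype S] : (Z → stdSimplex ℝ S) → Z → S → ℝ :=
  Pi.map fun _ => Subtype.val

variable {S X E : Type*} [Fintype S] [Fintype X] [MeasurableSpace E] {P : SMDP S X E}

namespace SMDP

theorem exists_meanTransition_eq_of_mem_convexHull [MeasurableSingletonClass E]
    {q : Gr P.Γ → stdSimplex ℝ S} {C : Set P.Θ}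
    (hq : transitionProb q ∈ convexHull ℝ (transitionProb '' (P.Qsub '' C))) :
    ∃ μ : ProbabilityMeasure P.Θ, (∀ᵐ θ ∂(μ : Measure P.Θ), θ ∈ C) ∧ P.meanTransition μ = q := by
  rw [Set.image_image] at hq
  obtain ⟨μ, hμC, -, hμ⟩ := exists_probabilityMeasure_integral_eq_of_mem_convexHull hq
  refine ⟨μ, hμC, funext fun z => stdSimplex.ext (funext fun s' => ?_)⟩
  have hint : ∀ z s', Integrable (fun θ => transitionProb (P.Qsub θ) z s') (μ : Measure P.Θ) :=
    P.integrable_Qsub μ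
  change ∫ θ, transitionProb (P.Qsub θ) z s' ∂(μ : Measure P.Θ) = transitionProb q z s'
  rw [← hμ, eval_integral fun z => Integrable.of_eval (hint z), eval_integral (hint z)]

/-- The domain of the best-response correspondence: a strategy, a distribution of states and
actions, and the transition probability function that is believed to be true. -/
abbrev Profile (P : SMDP S X E) : Type _ :=
  P.toMDP.Strategy × stdSimplex ℝ (Gr P.Γ) × (Gr P.Γ → stdSimplex ℝ S)

/-- The real coordinates of a profile. -/
def Profile.coords : P.Profile → (S → X → ℝ) × (Gr P.Γ → ℝ) × (Gr P.Γ → S → ℝ) :=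
  Prod.map MDP.Strategy.prob (Prod.map Subtype.val transitionProb)

/-- The best-response correspondence. Its third component is not convex: fixed points are sought
in the convex hull of its values, where mixtures over closest parameters are beliefs. -/
def response (P : SMDP S X E) (t : P.Profile) : Set P.Profile :=
  {σ : P.toMDP.Strategy | (P.toMDP.withTransition t.2.2).IsOptimal σ} ×ˢ
    {P.toMDP.push t.1 t.2.1} ×ˢ (P.Qsub '' P.closest t.2.1)

theorem nonempty_profile (P : SMDP S X E) : Nonempty P.Profile :=
  have : Nonempty (Gr P.Γ) := P.toMDP.nonempty_gr
  ⟨Classical.arbitrary _, Classical.arbitrary _, P.Q⟩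

theorem Profile.continuous_coords : Continuous (coords : P.Profile → _) :=
  MDP.Strategy.continuous_prob.prodMap
    (continuous_subtype_val.prodMap (Continuous.piMap fun _ => continuous_subtype_val))

theorem Profile.coords_injective : Function.Injective (coords : P.Profile → _) :=
  MDP.Strategy.prob_injective.prodMap
    (Subtype.val_injective.prodMap (Function.Injective.piMap fun _ => Subtype.val_injective))

theorem Profile.convex_range_coords : Convex ℝ (Set.range (coords : P.Profile → _)) := by
  rw [coords, Set.range_prodMap, Set.range_prodMap, transitionProb, Set.range_piMap]
  simp only [Subtype.range_val]
  exact MDP.Strategy.convex_range_prob.prod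
    ((convex_stdSimplex ℝ _).prod (convex_pi fun _ _ => convex_stdSimplex ℝ S))

theorem response_nonempty [TopologicalSpace E] (hΘ : IsCompact P.Θ) (hcont : Continuous P.Qsub)
    (t : P.Profile) : (P.response t).Nonempty :=
  Set.Nonempty.prod (P.toMDP.withTransition t.2.2).exists_isOptimal
    ((Set.singleton_nonempty _).prod ((closest_nonempty hΘ hcont t.2.1).image _))

theorem isClosed_setOf_mem_image_closest [TopologicalSpace E] (hΘ : IsCompact P.Θ)
    (hcont : Continuous P.Qsub) {D : Set P.Θ} (hD : Dense D)
    (hpos : ∀ θ ∈ D, ∀ z s', 0 < P.Q z s' → 0 < P.Qsub θ z s') :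
    IsClosed {p : stdSimplex ℝ (Gr P.Γ) × (Gr P.Γ → stdSimplex ℝ S) |
      p.2 ∈ P.Qsub '' P.closest p.1} := by
  have : CompactSpace P.Θ := isCompact_iff_compactSpace.1 hΘ
  have hclosed : IsClosed {p : (stdSimplex ℝ (Gr P.Γ) × (Gr P.Γ → stdSimplex ℝ S)) × P.Θ |
      p.2 ∈ P.closest p.1.1 ∧ P.Qsub p.2 = p.1.2} :=
    ((isClosed_setOf_mem_closest hcont hD hpos).preimage
      ((continuous_fst.comp continuous_fst).prodMk continuous_snd)).inter
      (isClosed_eq (hcont.comp continuous_snd) (continuous_snd.comp continuous_fst))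
  convert isClosedMap_fst_of_compactSpace _ hclosed using 1
  ext p
  exact ⟨fun ⟨θ, hθ⟩ => ⟨(p, θ), hθ, rfl⟩, fun ⟨⟨_, θ⟩, hθ, h⟩ => h ▸ ⟨θ, hθ⟩⟩

theorem isClosed_setOf_mem_response [TopologicalSpace E] (hΘ : IsCompact P.Θ)
    (hcont : Continuous P.Qsub) {D : Set P.Θ} (hD : Dense D)
    (hpos : ∀ θ ∈ D, ∀ z s', 0 < P.Q z s' → 0 < P.Qsub θ z s') :
    IsClosed {p : P.Profile × P.Profile | p.2 ∈ P.response p.1} := by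
  have hopt := P.toMDP.isClosed_setOf_isOptimal_withTransition.preimage
    (f := fun p : P.Profile × P.Profile => (p.2.1, p.1.2.2)) (by fun_prop)
  have hpush : IsClosed {p : P.Profile × P.Profile | p.2.2.1 = P.toMDP.push p.1.1 p.1.2.1} :=
    isClosed_eq (continuous_fst.comp (continuous_snd.comp continuous_snd))
      (P.toMDP.continuous_push.comp ((continuous_fst.comp continuous_fst).prodMk
        (continuous_fst.comp (continuous_snd.comp continuous_fst))))
  have hclosest := (isClosed_setOf_mem_image_closest hΘ hcont hD hpos).preimage
    (f := fun p : P.Profile × P.Profile => (p.1.2.1, p.2.2.2)) (by fun_prop)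
  exact hopt.inter (hpush.inter hclosest)

theorem isBerkNash_of_coords_mem_convexHull [MeasurableSingletonClass E] {t : P.Profile}
    (ht : t.coords ∈ convexHull ℝ (Profile.coords '' P.response t)) :
    P.IsBerkNash t.1 t.2.1 := by
  rw [Profile.coords, response, Set.prodMap_image_prod, Set.prodMap_image_prod, convexHull_prod,
    convexHull_prod, Set.image_singleton, convexHull_singleton] at ht
  obtain ⟨hσ, hm, hq⟩ := ht
  obtain ⟨μ, hμ, hmean⟩ := exists_meanTransition_eq_of_mem_convexHull hq
  refine ⟨μ, ?_, hμ, MDP.isStationary_of_eq_push (Subtype.ext hm)⟩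
  rw [hmean]
  exact MDP.isOptimal_of_prob_mem_convexHull hσ

end SMDP

end Equilibrium

theorem theorem1_general {S X E : Type*} [Fintype S] [Fintype X] [TopologicalSpace E]
    [MeasurableSpace E] [MeasurableSingletonClass E] (P : SMDP S X E) (hΘ : IsCompact P.Θ)
    (hcont : ∀ z s', Continuous fun θ => P.Qsub θ z s')
    (hdense : ∃ D : Set P.Θ, Dense D ∧ ∀ θ ∈ D, ∀ z s', 0 < P.Q z s' → 0 < P.Qsub θ z s') :
    ∃ (σ : P.toMDP.Strategy) (m : stdSimplex ℝ (Gr P.Γ)), P.IsBerkNash σ m := by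
  have : Nonempty P.Profile := P.nonempty_profile
  have hQ : Continuous P.Qsub := SMDP.continuous_Qsub hcont
  obtain ⟨D, hD, hpos⟩ := hdense
  obtain ⟨t, ht⟩ := exists_mem_convexHull_image_of_isClosed SMDP.Profile.continuous_coords
    SMDP.Profile.coords_injective SMDP.Profile.convex_range_coords
    (SMDP.isClosed_setOf_mem_response hΘ hQ hD hpos) (SMDP.response_nonempty hΘ hQ)
  exact ⟨t.1, t.2.1, SMDP.isBerkNash_of_coords_mem_convexHull ht⟩

theorem theorem1 {S X : Type*} [Fintype S] [Nonempty S] [Fintype X] [Nonempty X] {k : ℕ}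
    (P : SMDP S X (EuclideanSpace ℝ (Fin k))) (hP : P.IsRegular) :
    ∃ (σ : P.toMDP.Strategy) (m : stdSimplex ℝ (Gr P.Γ)), P.IsBerkNash σ m :=
  theorem1_general P hP.isCompact hP.continuous hP.dense
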